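/- Let $n\ge 3$ and let $G=D_n=\langle r,s : r^n=s^2=rsrs=1\rangle$ be the dihedral group of order $2n$. A skew left brace is a set $B$ with two group operations $\cdot$ and $\circ$ such that $a\circ(b\cdot c)=(a\circ b)\cdot a^{-1}\cdot(a\circ c)$ for all $a,b,c\in B$, where $a^{-1}$ is the inverse for $\cdot$. It gives the set-theoretic solution of the Yang–Baxter equation $R(a,b)=\bigl(a^{-1}(a\circ b),\ \overline{a^{-1}(a\circ b)}\circ a\circ b\bigr)$ on $B$, where $\overline{x}$ is the inverse of $x$ for $\circ$; the brace and the solution $R$ are said to be of type $G$ if $(B,\cdot)\cong(B,\circ)\cong G$. The opposite of a brace $(B,\cdot,\circ)$ is $(B,\cdot',\circ)$ with $a\cdot' b=b\cdot a$. Let $\mathrm{FPF}(G)$ be the set of endomorphisms $\psi$ of $G$ with abelian image and with no fixed point other than $1$. Each $\psi\in\mathrm{FPF}(G)$ gives the brace $\mathfrak B_\psi=(G,\cdot,\circ)$ with $g\circ h=g\psi(g^{-1})h\psi(g)$, the regular subgroup $N_\psi=\{h\mapsto gh\psi(g)^{-1} : g\in G\}$ of $\mathrm{Perm}(G)$, and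 the two solutions $$R_\psi(g,h)=\bigl(\psi(g^{-1})h\psi(g),\ \psi(hg^{-1})h^{-1}\psi(g)g\psi(g^{-1})h\psi(gh^{-1})\bigr),\qquad R'_\psi(g,h)=\bigl(g\psi(g^{-1})h\psi(g)g^{-1},\ \psi(h)g\psi(h^{-1})\bigr),$$ which belong to $\mathfrak B_\psi$ and to its opposite. The following are equivalent: 1. Every Yang–Baxter solution of type $D_n$ equals, up to a bijection of the underlying sets, $R_\psi$ or $R'_\psi$ for some $\psi\in\mathrm{FPF}(D_n)$. 2. Every brace of type $D_n$ is isomorphic to $\mathfrak B_\psi$ or to the opposite of $\mathfrak B_\psi$ for some $\psi\in\mathrm{FPF}(D_n)$. 3. Every regular subgroup of $\mathrm{Perm}(D_n)$ that is isomorphic to $D_n$ and normalized by the left translations is $N_\psi$, or the centralizer of $N_\psi$ in $\mathrm{Perm}(D_n)$, for some $\psi\in\mathrm{FPF}(D_n)$. 4. $n=p^k$ for an odd prime $p$ and an integer $k\ge1$, or $n=2p^k$ for an odd prime $p$ and an integer $k\ge 1$, or $n=4$. -/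

import Mathlib

universe u v w

/-- A skew left brace `(B, ·, ∘)` on the set `B`: two group structures `dot` and `circ` with
`a ∘ (b · c) = (a ∘ b) · a⁻¹ · (a ∘ c)`, where `a⁻¹` is the inverse for `·`. -/
structure SkewBrace (B : Type u) where
  dot : Group B
  circ : Group B
  brace_rel : ∀ a b c : B,
    circ.mul a (dot.mul b c) = dot.mul (dot.mul (circ.mul a b) (dot.inv a)) (circ.mul a c)

namespace SkewBrace

/-- The set `B` regarded as the group `(B, ·)`. -/
def Dot {B : Type u} (_ : SkewBrace B) : Type u := B

/-- The set `B` regarded as the group `(B, ∘)`. -/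
def Circ {B : Type u} (_ : SkewBrace B) : Type u := B

instance {B : Type u} (A : SkewBrace B) : Group A.Dot := A.dot

instance {B : Type u} (A : SkewBrace B) : Group A.Circ := A.circ

/-- The brace has type `(N, G)`: `(B, ·) ≅ N` and `(B, ∘) ≅ G`. -/
def IsOfType {B : Type u} (A : SkewBrace B) (N : Type v) (G : Type w) [Group N] [Group G] : Prop :=
  Nonempty (A.Dot ≃* N) ∧ Nonempty (A.Circ ≃* G)

/-- Isomorphism of braces: a bijection that preserves both operations. -/
def IsIsomorphic {B : Type u} {C : Type v} (A : SkewBrace B) (A' : SkewBrace C) : Prop :=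
  ∃ e : B ≃ C, (∀ a b, e (A.dot.mul a b) = A'.dot.mul (e a) (e b)) ∧
    (∀ a b, e (A.circ.mul a b) = A'.circ.mul (e a) (e b))

/-- The set-theoretic solution of the Yang-Baxter equation attached to a brace,
`R(a, b) = (a⁻¹ (a ∘ b), c ∘ a ∘ b)`, where `c` is the `∘`-inverse of `a⁻¹ (a ∘ b)`. -/
def solution {B : Type u} (A : SkewBrace B) : B × B → B × B := fun x =>
  let y := A.dot.mul (A.dot.inv x.1) (A.circ.mul x.1 x.2)
  (y, A.circ.mul (A.circ.mul (A.circ.inv y) x.1) x.2)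

/-- The opposite brace `(B, ·', ∘)`, where `a ·' b = b · a`. -/
def opposite {B : Type u} (A : SkewBrace B) : SkewBrace B where
  dot :=
    { mul := fun a b => A.dot.mul b a
      one := A.dot.one
      inv := A.dot.inv
      mul_assoc := fun a b c => (A.dot.mul_assoc c b a).symm
      one_mul := fun a => A.dot.mul_one a
      mul_one := fun a => A.dot.one_mul a
      inv_mul_cancel := fun a => @mul_inv_cancel B A.dot a }
  circ := A.circ
  brace_rel := fun a b c =>
    (A.brace_rel a c b).trans (A.dot.mul_assoc (A.circ.mul a c) (A.dot.inv a) (A.circ.mul a b))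

end SkewBrace

/-- `R` is a Yang-Baxter solution of type `G`: it is the solution attached to a brace both of whose
groups are isomorphic to `G`. -/
def IsSolutionOfType {B : Type u} (R : B × B → B × B) (G : Type v) [Group G] : Prop :=
  ∃ A : SkewBrace B, A.IsOfType G G ∧ R = A.solution

/-- Two set-theoretic solutions agree up to a bijection of the underlying sets. -/
def SolutionsEquivalent {B : Type u} {C : Type v} (R : B × B → B × B) (S : C × C → C × C) : Prop :=
  ∃ e : B ≃ C, ∀ x : B × B, S (Prod.map e e x) = Prod.map e e (R x)

/-- The endomorphism `ψ` is abelian: its image is abelian. -/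
def IsAbelianEnd {G : Type u} [Group G] (ψ : G →* G) : Prop :=
  ∀ g h : G, ψ g * ψ h = ψ h * ψ g

/-- `FPF(G)`: the fixed point free abelian endomorphisms of `G`. -/
def FPF (G : Type u) [Group G] : Set (G →* G) :=
  {ψ | (∀ g : G, ψ g = g → g = 1) ∧ IsAbelianEnd ψ}

/-- An abelian endomorphism is constant on conjugacy classes, in the form used below. -/
theorem IsAbelianEnd.map_circ {G : Type u} [Group G] {ψ : G →* G} (hψ : IsAbelianEnd ψ) (g h : G) :
    ψ (g * ψ g⁻¹ * h * ψ g) = ψ g * ψ h := by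
  have h1 : ψ (ψ g) * ψ h = ψ h * ψ (ψ g) := hψ _ _
  have h2 : (ψ (ψ g))⁻¹ * ψ h = ψ h * (ψ (ψ g))⁻¹ := by
    rw [inv_mul_eq_iff_eq_mul, ← mul_assoc, h1, mul_inv_cancel_right]
  simp only [map_mul, map_inv]
  rw [mul_assoc (ψ g), h2]
  group

/-- The group `(G, ∘)` with `g ∘ h = g ψ(g⁻¹) h ψ(g)` of an abelian endomorphism `ψ`. The three
anonymous structures are its multiplication, its inverse and its unit. -/
@[reducible]
def abelianEndCirc {G : Type u} [Group G] (ψ : G →* G) (hψ : IsAbelianEnd ψ) : Group G :=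
  @Group.ofLeftAxioms G ⟨fun g h => g * ψ g⁻¹ * h * ψ g⟩ ⟨fun g => ψ g * g⁻¹ * ψ g⁻¹⟩ ⟨1⟩
    (fun a b c => by
      change (a * ψ a⁻¹ * b * ψ a) * ψ (a * ψ a⁻¹ * b * ψ a)⁻¹ * c * ψ (a * ψ a⁻¹ * b * ψ a) =
        a * ψ a⁻¹ * (b * ψ b⁻¹ * c * ψ b) * ψ a
      rw [map_inv ψ (a * ψ a⁻¹ * b * ψ a), hψ.map_circ, hψ a b]
      simp only [map_inv]
      group)
    (fun a => by
      change 1 * ψ 1⁻¹ * a * ψ 1 = a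
      simp)
    (fun a => by
      change ψ a * a⁻¹ * ψ a⁻¹ * ψ (ψ a * a⁻¹ * ψ a⁻¹)⁻¹ * a * ψ (ψ a * a⁻¹ * ψ a⁻¹) = 1
      have h1 : ψ (ψ a * a⁻¹ * ψ a⁻¹) = ψ a⁻¹ := by
        have := hψ (ψ a) a⁻¹
        rw [map_mul, map_mul, this, map_inv ψ a, map_inv ψ (ψ a)]
        group
      rw [map_inv ψ (ψ a * a⁻¹ * ψ a⁻¹), h1, map_inv]
      group)

/-- The brace `(G, ·, ∘)` with `g ∘ h = g ψ(g⁻¹) h ψ(g)` of an abelian endomorphism `ψ`. -/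
def abelianEndBrace {G : Type u} [inst : Group G] (ψ : G →* G) (hψ : IsAbelianEnd ψ) :
    SkewBrace G where
  dot := inst
  circ := abelianEndCirc ψ hψ
  brace_rel := fun a b c => by
    change a * ψ a⁻¹ * (b * c) * ψ a = a * ψ a⁻¹ * b * ψ a * a⁻¹ * (a * ψ a⁻¹ * c * ψ a)
    simp only [map_inv]
    group

/-- The solution `R_ψ` of the Yang-Baxter equation. -/
def fpfSolution {G : Type u} [Group G] (ψ : G →* G) : G × G → G × G := fun x =>
  let g := x.1
  let h := x.2
  (ψ g⁻¹ * h * ψ g, ψ (h * g⁻¹) * h⁻¹ * ψ g * g * ψ g⁻¹ * h * ψ (g * h⁻¹))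

/-- The solution `R'_ψ` of the Yang-Baxter equation, obtained from the opposite brace. -/
def fpfSolutionOpp {G : Type u} [Group G] (ψ : G →* G) : G × G → G × G := fun x =>
  let g := x.1
  let h := x.2
  (g * ψ g⁻¹ * h * ψ g * g⁻¹, ψ h * g * ψ h⁻¹)

/-- A subgroup of `Perm(G)` is regular: it acts freely and transitively on `G`. -/
def IsRegularSubgroup {G : Type u} (N : Subgroup (Equiv.Perm G)) : Prop :=
  (∀ η ∈ N, ∀ g : G, η g = g ↔ η = 1) ∧ ∀ g h : G, ∃ η ∈ N, η g = h

/-- A subgroup of `Perm(G)` is `G`-stable: it is normalized by the left translations. -/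
def IsGStable {G : Type u} [Group G] (N : Subgroup (Equiv.Perm G)) : Prop :=
  ∀ η ∈ N, ∀ g : G, Equiv.mulLeft g * η * Equiv.mulLeft g⁻¹ ∈ N

/-- The subgroup `N_ψ = {λ(g) ρ(ψ(g)) : g ∈ G}` of `Perm(G)`; its elements are the maps
`h ↦ g h ψ(g)⁻¹`. -/
def fpfSubgroup {G : Type u} [Group G] (ψ : G →* G) : Subgroup (Equiv.Perm G) :=
  MonoidHom.range
    { toFun := fun g => Equiv.mulLeft g * Equiv.mulRight (ψ g)⁻¹
      map_one' := by ext h; simp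
      map_mul' := fun a b => by ext h; simp [mul_assoc] }

/-- Every Yang-Baxter solution of type `G` is, up to a bijection of the underlying sets, one of the
solutions `R_ψ`, `R'_ψ` with `ψ ∈ FPF(G)`. -/
def ObtainsEverySolution (G : Type v) [Group G] : Prop :=
  ∀ (B : Type u) (R : B × B → B × B), IsSolutionOfType R G →
    ∃ ψ ∈ FPF G, SolutionsEquivalent R (fpfSolution ψ) ∨ SolutionsEquivalent R (fpfSolutionOpp ψ)

/-- Every brace whose two groups are isomorphic to `G` is isomorphic to the brace of some
`ψ ∈ FPF(G)` or to the opposite of that brace. -/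
def ObtainsEveryBrace (G : Type v) [Group G] : Prop :=
  ∀ (B : Type u) (A : SkewBrace B), A.IsOfType G G →
    ∃ (ψ : G →* G) (hψ : ψ ∈ FPF G), A.IsIsomorphic (abelianEndBrace ψ hψ.2) ∨
      A.IsIsomorphic (abelianEndBrace ψ hψ.2).opposite

/-- Every regular `G`-stable subgroup of `Perm(G)` that is isomorphic to `G` is `N_ψ` for some
`ψ ∈ FPF(G)`, or the opposite (that is, the centralizer in `Perm(G)`) of such an `N_ψ`. -/
def ObtainsEverySubgroup (G : Type v) [Group G] : Prop :=
  ∀ N : Subgroup (Equiv.Perm G), IsRegularSubgroup N → IsGStable N → Nonempty (N ≃* G) →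
    ∃ ψ ∈ FPF G, N = fpfSubgroup ψ ∨
      N = Subgroup.centralizer (fpfSubgroup ψ : Set (Equiv.Perm G))

/-! Condition 4 holds exactly when `1` and `-1` are the only square roots of `1` modulo `n`; that
property is what the braces see.

If `w * w = 1` with `w ≠ ±1`, rescaling the indices of the reflections by `w` and transporting the
multiplication gives a second operation `∘` and a brace of type `D_n`. Its solution is neither `R_ψ`
nor `R'_ψ`. Those contain conjugations by values of `ψ`, which square to `1`; for `n ≥ 5` an
involution commuting with `n` elements is central. The corresponding permutations in the twisted
solution fix all rotations but move a reflection (`not_obtainsEverySolution`). This argument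
survives arbitrary bijections of the underlying sets.

Conversely, write `g ∘ h = g * lam g h`. Each `lam g` is an automorphism of `D_n`, hence affine on
indices, and its linear part squares to `1`, so it is `±1`. If all rotations have linear part `1`,
the brace is trivial or almost trivial (`lam_of_lin_r_eq_one`). Otherwise, after passing to the
opposite if necessary, `lam` takes only two values, the identity and conjugation by a reflection
`b`, and sending `g` to `1` or `b` accordingly is the required `ψ` (`exists_fpf_of_lin_eq_neg_one`).

Braces and regular subgroups are matched for any finite group by turning left translations of `(B,
·)` into permutations of `(B, ∘) ≅ G`; opposites correspond to centralizers. -/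

/-! ### The isomorphism between `(G, ∘)` and `G`. -/

/-- The map `g ↦ g ψ(g)⁻¹` of a fixed point free endomorphism is injective. -/
theorem injective_mul_map_inv {G : Type u} [Group G] {ψ : G →* G} (hψ : ∀ g, ψ g = g → g = 1) :
    Function.Injective fun g => g * (ψ g)⁻¹ := by
  intro g h hgh
  have hgh' : g * (ψ g)⁻¹ = h * (ψ h)⁻¹ := hgh
  have : ψ (h⁻¹ * g) = h⁻¹ * g := by
    rw [mul_inv_eq_iff_eq_mul, mul_assoc] at hgh'
    rw [map_mul, map_inv, eq_inv_mul_iff_mul_eq]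
    exact hgh'.symm
  exact (inv_mul_eq_one.mp (hψ _ this)).symm

/-- For `ψ` fixed point free on a finite group, `g ↦ g ψ(g)⁻¹` is a bijection. -/
noncomputable def fpfEquiv {G : Type u} [Group G] [Finite G] (ψ : G →* G) (hψ : ψ ∈ FPF G) :
    G ≃ G :=
  Equiv.ofBijective (fun g => g * (ψ g)⁻¹)
    (Finite.injective_iff_bijective.mp (injective_mul_map_inv hψ.1))

theorem fpfEquiv_apply {G : Type u} [Group G] [Finite G] (ψ : G →* G) (hψ : ψ ∈ FPF G) (g : G) :
    fpfEquiv ψ hψ g = g * (ψ g)⁻¹ := rfl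

/-- `g ↦ g ψ(g)⁻¹` carries the operation `∘` of `𝔅_ψ` to the multiplication of `G`. -/
theorem fpfEquiv_circ {G : Type u} [Group G] [Finite G] (ψ : G →* G) (hψ : ψ ∈ FPF G) (g h : G) :
    fpfEquiv ψ hψ (g * ψ g⁻¹ * h * ψ g) = fpfEquiv ψ hψ g * fpfEquiv ψ hψ h := by
  simp only [fpfEquiv_apply, hψ.2.map_circ]
  rw [hψ.2 g h]
  simp only [map_inv]
  group

theorem mem_fpfSubgroup {G : Type u} [Group G] {ψ : G →* G} {η : Equiv.Perm G} :
    η ∈ fpfSubgroup ψ ↔ ∃ g, ∀ h, η h = g * h * (ψ g)⁻¹ := by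
  constructor
  · rintro ⟨g, rfl⟩
    exact ⟨g, fun h => by simp [mul_assoc]⟩
  · rintro ⟨g, hg⟩
    refine ⟨g, Equiv.ext fun h => ?_⟩
    simp [hg, mul_assoc]

/-! ### From braces to solutions. -/

namespace SkewBrace

theorem solution_equivalent {B : Type u} {C : Type v} {A : SkewBrace B} {A' : SkewBrace C}
    (h : A.IsIsomorphic A') : SolutionsEquivalent A.solution A'.solution := by
  obtain ⟨e, hd, hc⟩ := h
  have hdi : ∀ a, e (A.dot.inv a) = A'.dot.inv (e a) :=
    (MonoidHom.mk' (M := A.Dot) (G := A'.Dot) e hd).map_inv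
  have hci : ∀ a, e (A.circ.inv a) = A'.circ.inv (e a) :=
    (MonoidHom.mk' (M := A.Circ) (G := A'.Circ) e hc).map_inv
  refine ⟨e, fun x => ?_⟩
  simp only [solution, Prod.map, hd, hc, hdi, hci]

theorem IsIsomorphic.opposite {B : Type u} {C : Type v} {A : SkewBrace B} {A' : SkewBrace C}
    (h : A.IsIsomorphic A') : A.opposite.IsIsomorphic A'.opposite := by
  obtain ⟨e, hd, hc⟩ := h
  exact ⟨e, fun a b => hd b a, hc⟩

end SkewBrace

/-- Serves the second components of both `R_ψ` and `R'_ψ`: their first components are conjugates of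
`h` or have the same image under `ψ`, and only that image matters here. -/
theorem abelianEndCirc_inv_mul_mul {G : Type u} [Group G] (ψ : G →* G) (hψ : IsAbelianEnd ψ)
    (g h y : G) (hy : ψ y = ψ h) :
    (abelianEndCirc ψ hψ).mul ((abelianEndCirc ψ hψ).mul ((abelianEndCirc ψ hψ).inv y) g) h =
      ψ h * y⁻¹ * (g * ψ g⁻¹ * h * ψ g) * ψ h⁻¹ := by
  have hi : ψ (ψ y * y⁻¹ * ψ y⁻¹) = ψ h⁻¹ := by
    rw [map_mul, map_mul, hψ (ψ y) y⁻¹, map_inv ψ y, map_inv ψ (ψ y), hy, map_inv]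
    group
  refine ((abelianEndCirc ψ hψ).mul_assoc _ _ _).trans ?_
  change (ψ y * y⁻¹ * ψ y⁻¹) * ψ (ψ y * y⁻¹ * ψ y⁻¹)⁻¹ * (g * ψ g⁻¹ * h * ψ g) *
    ψ (ψ y * y⁻¹ * ψ y⁻¹) = _
  rw [map_inv ψ (ψ y * y⁻¹ * ψ y⁻¹), hi, map_inv ψ y, hy, map_inv ψ h]
  group

theorem abelianEndBrace_solution {G : Type u} [Group G] (ψ : G →* G) (hψ : IsAbelianEnd ψ) :
    (abelianEndBrace ψ hψ).solution = fpfSolution ψ := by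
  funext ⟨g, h⟩
  have h1 : g⁻¹ * (g * ψ g⁻¹ * h * ψ g) = ψ g⁻¹ * h * ψ g := by group
  have h2 : ψ (g⁻¹ * (g * ψ g⁻¹ * h * ψ g)) = ψ h := by
    rw [map_mul, hψ.map_circ, map_inv]; group
  refine Prod.ext h1 ((abelianEndCirc_inv_mul_mul ψ hψ g h _ h2).trans ?_)
  rw [h1]
  change _ = ψ (h * g⁻¹) * h⁻¹ * ψ g * g * ψ g⁻¹ * h * ψ (g * h⁻¹)
  simp only [map_mul, map_inv]
  group

theorem abelianEndBrace_opposite_solution {G : Type u} [Group G] (ψ : G →* G)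
    (hψ : IsAbelianEnd ψ) :
    (abelianEndBrace ψ hψ).opposite.solution = fpfSolutionOpp ψ := by
  funext ⟨g, h⟩
  have h2 : ψ (g * ψ g⁻¹ * h * ψ g * g⁻¹) = ψ h := by
    rw [map_mul, hψ.map_circ, hψ g h, map_inv]; group
  refine Prod.ext rfl ((abelianEndCirc_inv_mul_mul ψ hψ g h _ h2).trans ?_)
  change _ = ψ h * g * ψ h⁻¹
  group

theorem ObtainsEveryBrace.obtainsEverySolution {G : Type v} [Group G]
    (h : ObtainsEveryBrace.{u, v} G) : ObtainsEverySolution.{u, v} G := by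
  rintro B R ⟨A, hA, rfl⟩
  obtain ⟨ψ, hψ, h | h⟩ := h B A hA
  · exact ⟨ψ, hψ, Or.inl (abelianEndBrace_solution ψ hψ.2 ▸ SkewBrace.solution_equivalent h)⟩
  · exact ⟨ψ, hψ, Or.inr
      (abelianEndBrace_opposite_solution ψ hψ.2 ▸ SkewBrace.solution_equivalent h)⟩

/-! ### Braces and regular `G`-stable subgroups. -/

namespace SkewBrace

variable {B : Type u} {G : Type v} [Group G]

theorem dot_mul_one (A : SkewBrace B) (a : B) : A.dot.mul a A.dot.one = a :=
  A.dot.mul_one a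

/-- The units of the two groups agree: the brace relation at `b = c = 1` reads `x = x a⁻¹ x` for `x
= a ∘ 1`. -/
theorem circ_mul_one (A : SkewBrace B) (a : B) : A.circ.mul a A.dot.one = a := by
  let x : A.Dot := A.circ.mul a A.dot.one
  let y : A.Dot := a
  have h' : x = x * y⁻¹ * x :=
    (congrArg (A.circ.mul a) (A.dot_mul_one A.dot.one)).symm.trans
      (A.brace_rel a A.dot.one A.dot.one)
  rw [right_eq_mul, mul_inv_eq_one] at h'
  exact h'

theorem map_dot_one (A : SkewBrace B) (E : B ≃ G)
    (hE : ∀ a b : B, E (A.circ.mul a b) = E a * E b) : E A.dot.one = 1 := by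
  have h := hE A.dot.one A.dot.one
  rw [circ_mul_one] at h
  exact left_eq_mul.mp h

/-- A bijection that carries `∘` to the multiplication of `G` and the left translations of `(B, ·)`
into `N_ψ` yields an isomorphism with `𝔅_ψ`. -/
theorem isIsomorphic_abelianEndBrace [Finite G] (A : SkewBrace B) (E : B ≃ G)
    (hE : ∀ a b : B, E (A.circ.mul a b) = E a * E b) (ψ : G →* G) (hψ : ψ ∈ FPF G)
    (h : ∀ a : B, ∃ g, ∀ b : B, E (A.dot.mul a b) = g * E b * (ψ g)⁻¹) :
    A.IsIsomorphic (abelianEndBrace ψ hψ.2) := by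
  set θ := fpfEquiv ψ hψ with hθ
  set f : B ≃ G := E.trans θ.symm with hf
  have hEf : ∀ a, E a = θ (f a) := fun a => by simp [hf]
  have key : ∀ a b : B, E (A.dot.mul a b) = f a * E b * (ψ (f a))⁻¹ := by
    intro a b
    obtain ⟨g, hg⟩ := h a
    -- Evaluation at the unit gives `E a = g ψ(g)⁻¹`, which forces `g = f a`.
    have hg1 := hg A.dot.one
    rw [A.dot_mul_one, A.map_dot_one E hE, mul_one, ← fpfEquiv_apply ψ hψ, ← hθ, hEf,
      θ.apply_eq_iff_eq] at hg1
    rw [hg1, hg]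
  refine ⟨f, fun a b => θ.injective ?_, fun a b => θ.injective ?_⟩
  · change _ = θ (f a * f b)
    rw [← hEf, key, hEf b, hθ, fpfEquiv_apply, fpfEquiv_apply, map_mul]
    group
  · change _ = θ (f a * ψ (f a)⁻¹ * f b * ψ (f a))
    rw [← hEf, hE, hEf, hEf, hθ, fpfEquiv_circ]

end SkewBrace

/-- After identifying `(B, ∘)` with `G`, the left translations of `(B, ·)` form a regular subgroup,
and the brace relation says precisely that it is `G`-stable. -/
theorem ObtainsEverySubgroup.obtainsEveryBrace {G : Type v} [Group G] [Finite G]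
    (h : ObtainsEverySubgroup G) : ObtainsEveryBrace.{u, v} G := by
  rintro B A ⟨⟨e₁⟩, ⟨e⟩⟩
  let E : B ≃ G := e.toEquiv
  have hE : ∀ a b : B, E (A.circ.mul a b) = E a * E b := e.map_mul
  let D : A.Dot ≃ G := E
  let T : A.Dot →* Equiv.Perm G :=
    { toFun := fun a => D.permCongr (Equiv.mulLeft a)
      map_one' := by ext; simp
      map_mul' := fun a b => by ext; simp }
  have hT : ∀ a g, T a g = D (a * D.symm g) := fun a g => rfl
  have hT' : ∀ a b : B, T a (E b) = E (A.dot.mul a b) := fun a b =>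
    congrArg (fun x => E (A.dot.mul a x)) (E.symm_apply_apply b)
  have hTfree : ∀ a g, T a g = g → a = 1 := by
    intro a g hag
    rw [hT, ← D.eq_symm_apply, mul_eq_right] at hag
    exact hag
  have hreg : IsRegularSubgroup T.range := by
    refine ⟨?_, fun g k => ⟨T (D.symm k * (D.symm g)⁻¹), ⟨_, rfl⟩, ?_⟩⟩
    · rintro _ ⟨a, rfl⟩ g
      refine ⟨fun hag => by rw [hTfree a g hag, map_one], fun hag => by rw [hag]; rfl⟩
    · rw [hT, inv_mul_cancel_right, D.apply_symm_apply]
  have hst : IsGStable T.range := by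
    rintro _ ⟨a, rfl⟩ g
    obtain ⟨x, rfl⟩ := E.surjective g
    refine ⟨A.dot.mul (A.circ.mul x a) (A.dot.inv x), Equiv.ext fun k => ?_⟩
    obtain ⟨y, hy⟩ := E.surjective ((E x)⁻¹ * k)
    obtain rfl : k = E (A.circ.mul x y) := by rw [hE, hy]; simp
    simp only [Equiv.Perm.mul_apply, Equiv.coe_mulLeft]
    rw [← hy, hT' a y, hT' _ _]
    exact (congrArg E (A.brace_rel x a y).symm).trans (hE _ _)
  have hinj : Function.Injective T := (injective_iff_map_eq_one T).mpr fun a ha =>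
    hTfree a 1 (by rw [ha]; rfl)
  obtain ⟨ψ, hψ, hN | hN⟩ := h T.range hreg hst
    ⟨(MonoidHom.ofInjective hinj).symm.trans e₁⟩
  · refine ⟨ψ, hψ, Or.inl (A.isIsomorphic_abelianEndBrace E hE ψ hψ fun a => ?_)⟩
    have ha : T a ∈ fpfSubgroup ψ := hN ▸ ⟨a, rfl⟩
    obtain ⟨g, hg⟩ := mem_fpfSubgroup.mp ha
    exact ⟨g, fun b => (hT' a b).symm.trans (hg _)⟩
  · refine ⟨ψ, hψ, Or.inr (SkewBrace.IsIsomorphic.opposite (A := A.opposite)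
      (A.opposite.isIsomorphic_abelianEndBrace E hE ψ hψ fun a => ?_))⟩
    obtain ⟨g, hg⟩ := (fpfEquiv ψ hψ).surjective (E a)
    refine ⟨g, fun b => ?_⟩
    have hη : Equiv.mulLeft g * Equiv.mulRight (ψ g)⁻¹ ∈ fpfSubgroup ψ := ⟨g, rfl⟩
    have hb : T b ∈ Subgroup.centralizer (fpfSubgroup ψ : Set (Equiv.Perm G)) :=
      hN ▸ ⟨b, rfl⟩
    -- Left translation by `b` commutes with `h ↦ g h ψ(g)⁻¹`; at `1` this shows that the latter is
    -- right translation by `a`, that is, left translation in the opposite brace.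
    have hcomm := DFunLike.congr_fun (Subgroup.mem_centralizer_iff.mp hb _ hη) 1
    simp only [Equiv.Perm.mul_apply, Equiv.coe_mulLeft, Equiv.coe_mulRight, one_mul] at hcomm
    rw [← fpfEquiv_apply ψ hψ, hg, hT' b a, ← A.map_dot_one E hE, hT' b _, A.dot_mul_one,
      ← mul_assoc] at hcomm
    exact hcomm.symm

/-- Conjugating a fixed point free abelian endomorphism by an automorphism gives another one. -/
theorem conj_mem_FPF {G : Type v} [Group G] (α : G ≃* G) {ψ : G →* G} (hψ : ψ ∈ FPF G) :
    (α.symm.toMonoidHom.comp (ψ.comp α.toMonoidHom)) ∈ FPF G := by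
  refine ⟨fun g hg => ?_, fun g k => ?_⟩
  · have : ψ (α g) = α g := by
      rw [← α.symm_apply_eq]
      exact hg
    exact (MulEquiv.map_eq_one_iff α).mp (hψ.1 _ this)
  · change α.symm (ψ (α g)) * α.symm (ψ (α k)) = α.symm (ψ (α k)) * α.symm (ψ (α g))
    rw [← map_mul, hψ.2, map_mul]

/-- Evaluation at `1` identifies `N` with `G`, so `N` carries both composition and the
multiplication of `G`. A brace isomorphism to `𝔅_ψ` then recovers `N` as the subgroup of `ψ`
conjugated by an automorphism of `G`. -/
theorem ObtainsEveryBrace.obtainsEverySubgroup {G : Type v} [Group G] [Finite G]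
    (h : ObtainsEveryBrace.{v, v} G) : ObtainsEverySubgroup G := by
  intro N hreg hst ⟨ι⟩
  have hbij : Function.Bijective fun η : N => (η : Equiv.Perm G) 1 := by
    refine ⟨fun a b hab => ?_, fun g => ?_⟩
    · have hab' : (a : Equiv.Perm G) 1 = (b : Equiv.Perm G) 1 := hab
      have := (hreg.1 _ (N.mul_mem (N.inv_mem b.2) a.2) 1).mp (by
        rw [Equiv.Perm.mul_apply, hab', Equiv.Perm.inv_eq_iff_eq])
      exact Subtype.ext (inv_mul_eq_one.mp this).symm
    · obtain ⟨η, hη, h1⟩ := hreg.2 1 g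
      exact ⟨⟨η, hη⟩, h1⟩
  let ev : N ≃ G := Equiv.ofBijective _ hbij
  have hev : ∀ a : N, ev a = (a : Equiv.Perm G) 1 := fun _ => rfl
  have hact : ∀ a b : N, (a : Equiv.Perm G) (ev b) = ev (a * b) := fun _ _ => rfl
  -- The right side lies in `N` by stability and sends `1` to `ev a * ev b`; regularity makes it the
  -- only such element. The brace relation is then a cancellation.
  have hcirc : ∀ a b : N, (ev.symm (ev a * ev b) : Equiv.Perm G) =
      Equiv.mulLeft (ev a) * b * Equiv.mulLeft (ev a)⁻¹ * a := by
    intro a b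
    have : ev.symm (ev a * ev b) = ⟨_, N.mul_mem (hst b b.2 (ev a)) a.2⟩ := by
      rw [Equiv.symm_apply_eq]
      simp [hev]
    rw [this]
  let A : SkewBrace N :=
    { dot := inferInstance
      circ := ev.group
      brace_rel := fun a b c => by
        change ev.symm (ev a * ev (b * c)) =
          ev.symm (ev a * ev b) * a⁻¹ * ev.symm (ev a * ev c)
        refine Subtype.ext ?_
        simp only [Subgroup.coe_mul, Subgroup.coe_inv, hcirc]
        ext
        simp }
  have hA : A.IsOfType G G := ⟨⟨ι⟩, ⟨{ ev with map_mul' := fun a b => ev.apply_symm_apply _ }⟩⟩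
  obtain ⟨ψ, hψ, hiso⟩ := h N A hA
  obtain ⟨f, hfcirc, hfdot⟩ : ∃ f : N ≃ G,
      (∀ a b : N, f (ev.symm (ev a * ev b)) = f a * ψ (f a)⁻¹ * f b * ψ (f a)) ∧
      ((∀ a b : N, f (a * b) = f a * f b) ∨ (∀ a b : N, f (a * b) = f b * f a)) := by
    rcases hiso with ⟨f, hd, hc⟩ | ⟨f, hd, hc⟩
    · exact ⟨f, hc, Or.inl hd⟩
    · exact ⟨f, hc, Or.inr hd⟩
  set θ := fpfEquiv ψ hψ with hθ
  have hθmul : ∀ a b, θ (a * b) = a * θ b * (ψ a)⁻¹ := fun a b => by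
    simp only [hθ, fpfEquiv_apply, map_mul]; group
  -- `f` carries the multiplication pulled back from `G` to `∘`, and `θ` carries `∘` back to the
  -- multiplication, so the composite is an automorphism.
  let α : G ≃* G :=
    { (ev.symm.trans f).trans θ with
      map_mul' := fun g k => by
        obtain ⟨a, rfl⟩ := ev.surjective g
        obtain ⟨b, rfl⟩ := ev.surjective k
        change θ (f (ev.symm (ev a * ev b))) = θ (f (ev.symm (ev a))) * θ (f (ev.symm (ev b)))
        rw [hfcirc, hθ, fpfEquiv_circ, Equiv.symm_apply_apply, Equiv.symm_apply_apply] }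
  have hα : ∀ a, α (ev a) = θ (f a) := fun a =>
    congrArg (fun x => θ (f x)) (ev.symm_apply_apply a)
  -- Read through `f`, membership means being a left translation by some `f μ`. If `f` is
  -- multiplicative this is left translation by `μ` in `N`; if it reverses products it is right
  -- translation, and `N` is the centralizer of those.
  have hmem : ∀ π : Equiv.Perm G,
      π ∈ fpfSubgroup (α.symm.toMonoidHom.comp (ψ.comp α.toMonoidHom)) ↔
        ∃ μ : N, ∀ ζ : N, f (ev.symm (π (ev ζ))) = f μ * f ζ := by
    intro π
    have hstep : ∀ (μ ζ : N), π (ev ζ) = α.symm (f μ) * ev ζ *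
        ((α.symm.toMonoidHom.comp (ψ.comp α.toMonoidHom)) (α.symm (f μ)))⁻¹ ↔
        f (ev.symm (π (ev ζ))) = f μ * f ζ := by
      intro μ ζ
      obtain ⟨ξ, hξ⟩ := ev.surjective (π (ev ζ))
      rw [← hξ, Equiv.symm_apply_apply, ← α.apply_eq_iff_eq, hα, map_mul, map_mul, map_inv,
        α.apply_symm_apply, hα]
      change _ = f μ * θ (f ζ) * (α (α.symm (ψ (α (α.symm (f μ))))))⁻¹ ↔ _
      rw [α.apply_symm_apply, α.apply_symm_apply, ← hθmul, θ.apply_eq_iff_eq]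
    rw [mem_fpfSubgroup]
    constructor
    · rintro ⟨g, hg⟩
      refine ⟨f.symm (α g), fun ζ => (hstep _ ζ).mp ?_⟩
      rw [f.apply_symm_apply, α.symm_apply_apply]
      exact hg _
    · rintro ⟨μ, hμ⟩
      refine ⟨α.symm (f μ), fun k => ?_⟩
      obtain ⟨ζ, rfl⟩ := ev.surjective k
      exact (hstep μ ζ).mpr (hμ ζ)
  refine ⟨_, conj_mem_FPF α hψ, ?_⟩
  rcases hfdot with hfdot | hfdot
  · left
    ext π
    rw [hmem]
    constructor
    · intro hπ
      refine ⟨⟨π, hπ⟩, fun ζ => ?_⟩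
      rw [← hfdot]
      exact congrArg f (ev.symm_apply_apply (⟨π, hπ⟩ * ζ))
    · rintro ⟨μ, hμ⟩
      have : π = μ := by
        ext k
        obtain ⟨ζ, rfl⟩ := ev.surjective k
        have := hμ ζ
        rw [← hfdot, f.apply_eq_iff_eq, Equiv.symm_apply_eq] at this
        rw [this, hact]
      rw [this]
      exact μ.2
  · right
    have hmem' : ∀ π ∈ fpfSubgroup (α.symm.toMonoidHom.comp (ψ.comp α.toMonoidHom)),
        ∃ μ : N, ∀ ζ : N, π (ev ζ) = ev (ζ * μ) := by
      intro π hπ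
      obtain ⟨μ, hμ⟩ := (hmem π).mp hπ
      refine ⟨μ, fun ζ => ?_⟩
      rw [← Equiv.symm_apply_eq, ← f.apply_eq_iff_eq, hμ, hfdot]
    ext π
    rw [Subgroup.mem_centralizer_iff]
    constructor
    · intro hπ τ hτ
      obtain ⟨μ, hμ⟩ := hmem' τ hτ
      ext k
      obtain ⟨ζ, rfl⟩ := ev.surjective k
      have hact' : ∀ ζ : N, π (ev ζ) = ev (⟨π, hπ⟩ * ζ) := hact ⟨π, hπ⟩
      rw [Equiv.Perm.mul_apply, Equiv.Perm.mul_apply, hact', hμ, hμ, hact', mul_assoc]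
    · intro hπ
      obtain ⟨ζ, hζ⟩ := ev.surjective (π 1)
      have : π = ζ := by
        ext k
        obtain ⟨μ, rfl⟩ := ev.surjective k
        let τ : Equiv.Perm G := ev.permCongr (Equiv.mulRight μ)
        have hτ : ∀ ξ : N, τ (ev ξ) = ev (ξ * μ) := fun ξ => by simp [τ]
        have hτmem : τ ∈ fpfSubgroup (α.symm.toMonoidHom.comp (ψ.comp α.toMonoidHom)) :=
          (hmem τ).mpr ⟨μ, fun ξ => by rw [hτ, Equiv.symm_apply_apply, hfdot]⟩
        have hcomm := DFunLike.congr_fun (hπ τ hτmem) (ev 1)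
        have h1 : π (ev 1) = ev ζ := by rw [hζ]; rfl
        rw [Equiv.Perm.mul_apply, Equiv.Perm.mul_apply, h1, hτ, hτ, one_mul] at hcomm
        rw [← hcomm, hact]
      rw [this]
      exact ζ.2

/-! ### Square roots of `1` modulo `n`. -/

/-- A cyclic group has at most two solutions of `x ^ 2 = 1`, and `1 ≠ -1` already supplies two. -/
theorem ZMod.eq_one_or_eq_neg_one_of_isCyclic_units {n : ℕ} (hn : 3 ≤ n)
    (hc : IsCyclic (ZMod n)ˣ) {w : ZMod n} (hw : w * w = 1) : w = 1 ∨ w = -1 := by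
  have : Fact (2 < n) := ⟨hn⟩
  have : NeZero n := ⟨by omega⟩
  have h1 : (1 : (ZMod n)ˣ) ≠ -1 := fun h =>
    ZMod.neg_one_ne_one (congrArg Units.val h).symm
  let x : (ZMod n)ˣ := ⟨w, w, hw, hw⟩
  by_contra! hne
  have hx1 : (1 : (ZMod n)ˣ) ≠ x := fun h => hne.1 (congrArg Units.val h).symm
  have hx2 : (-1 : (ZMod n)ˣ) ≠ x := fun h => hne.2 (congrArg Units.val h).symm
  have hcard := IsCyclic.card_pow_eq_one_le (α := (ZMod n)ˣ) (n := 2) two_pos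
  have hsub : ({1, -1, x} : Finset (ZMod n)ˣ) ⊆ Finset.univ.filter fun a => a ^ 2 = 1 := by
    intro a ha
    simp only [Finset.mem_insert, Finset.mem_singleton] at ha
    rcases ha with rfl | rfl | rfl
    · simp
    · simp
    · simp [x, sq, Units.ext_iff, hw]
  have := (Finset.card_le_card hsub).trans hcard
  rw [Finset.card_eq_three.mpr ⟨1, -1, x, h1, hx1, hx2, rfl⟩] at this
  omega

theorem ZMod.exists_sq_eq_one_of_coprime {a b : ℕ} (ha : 3 ≤ a) (hb : 3 ≤ b)
    (hab : a.Coprime b) : ∃ w : ZMod (a * b), w * w = 1 ∧ w ≠ 1 ∧ w ≠ -1 := by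
  have : Fact (2 < a) := ⟨ha⟩
  have : Fact (2 < b) := ⟨hb⟩
  let e := ZMod.chineseRemainder hab
  refine ⟨e.symm (1, -1), ?_, fun h => ?_, fun h => ?_⟩
  · rw [← map_mul, RingEquiv.symm_apply_eq, map_one]
    simp
  · rw [RingEquiv.symm_apply_eq, map_one] at h
    exact ZMod.neg_one_ne_one (congrArg Prod.snd h)
  · rw [RingEquiv.symm_apply_eq, map_neg, map_one] at h
    exact ZMod.neg_one_ne_one (congrArg Prod.fst h).symm

/-- The witness is one plus half the modulus. -/
theorem ZMod.exists_sq_eq_one_of_two_pow (k : ℕ) :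
    ∃ w : ZMod (2 ^ (k + 3)), w * w = 1 ∧ w ≠ 1 ∧ w ≠ -1 := by
  have hpos : 0 < 2 ^ k := by positivity
  have hpow : 2 ^ (k + 3) = 8 * 2 ^ k := by ring
  refine ⟨((1 + 2 ^ (k + 2) : ℕ) : ZMod (2 ^ (k + 3))), ?_, fun h => ?_, fun h => ?_⟩
  · have : ((1 + 2 ^ (k + 2)) * (1 + 2 ^ (k + 2)) : ℕ) = 1 + 2 ^ (k + 3) * (1 + 2 ^ (k + 1)) := by
      ring
    rw [← Nat.cast_mul, this, Nat.cast_add, Nat.cast_mul, ZMod.natCast_self]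
    simp
  · rw [Nat.cast_add, Nat.cast_one, add_eq_left, ZMod.natCast_eq_zero_iff] at h
    have := Nat.le_of_dvd (by positivity) h
    rw [hpow, show 2 ^ (k + 2) = 4 * 2 ^ k by ring] at this
    omega
  · rw [eq_neg_iff_add_eq_zero, ← Nat.cast_succ, ZMod.natCast_eq_zero_iff] at h
    have := Nat.le_of_dvd (by positivity) h
    rw [hpow, show 2 ^ (k + 2) = 4 * 2 ^ k by ring] at this
    omega

theorem ZMod.exists_sq_eq_one {n : ℕ} (hn : 3 ≤ n)
    (h : ¬((∃ p k : ℕ, p.Prime ∧ Odd p ∧ 0 < k ∧ n = p ^ k) ∨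
      (∃ p k : ℕ, p.Prime ∧ Odd p ∧ 0 < k ∧ n = 2 * p ^ k) ∨ n = 4)) :
    ∃ w : ZMod n, w * w = 1 ∧ w ≠ 1 ∧ w ≠ -1 := by
  by_cases hp : ∃ p, p.Prime ∧ Odd p ∧ p ∣ n
  · obtain ⟨p, hp, hodd, hdvd⟩ := hp
    obtain ⟨k, c, hc, rfl⟩ := Nat.exists_eq_pow_mul_and_not_dvd (by omega : n ≠ 0) p hp.ne_one
    have hk : 0 < k := by
      rcases Nat.eq_zero_or_pos k with rfl | hk
      · simp [hc] at hdvd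
      · exact hk
    have hp3 : 3 ≤ p := by
      have := hp.two_le
      obtain ⟨j, rfl⟩ := hodd
      omega
    have hpk : 3 ≤ p ^ k := hp3.trans (Nat.le_self_pow hk.ne' p)
    -- The cofactors `1` and `2` give exactly the excluded forms `p ^ k` and `2 * p ^ k`.
    have hc3 : 3 ≤ c := by
      by_contra! hlt
      interval_cases c
      · simp at hc
      · exact h (Or.inl ⟨p, k, hp, hodd, hk, mul_one _⟩)
      · exact h (Or.inr (Or.inl ⟨p, k, hp, hodd, hk, mul_comm _ _⟩))
    exact ZMod.exists_sq_eq_one_of_coprime hpk hc3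
      (Nat.Coprime.pow_left k ((Nat.Prime.coprime_iff_not_dvd hp).mpr hc))
  · have hpow : n = 2 ^ n.primeFactorsList.length :=
      Nat.eq_prime_pow_of_unique_prime_dvd (by omega) fun {q} hq hqn =>
        hq.eq_two_or_odd'.resolve_right fun ho => hp ⟨q, hq, ho, hqn⟩
    obtain ⟨k, rfl⟩ : ∃ k, n = 2 ^ k := ⟨_, hpow⟩
    have hk : 3 ≤ k := by
      by_contra! hlt
      interval_cases k
      · omega
      · omega
      · exact h (Or.inr (Or.inr rfl))
    obtain ⟨j, rfl⟩ := Nat.exists_eq_add_of_le' hk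
    exact ZMod.exists_sq_eq_one_of_two_pow j

/-! ### Twisted braces, which violate the solution condition. -/

namespace DihedralGroup

/-- `D_n` is generated by involutions, and products of commuting involutions square to `1`. -/
theorem map_mul_self_of_isAbelianEnd {n : ℕ} {ψ : DihedralGroup n →* DihedralGroup n}
    (hψ : IsAbelianEnd ψ) (x : DihedralGroup n) : ψ x * ψ x = 1 := by
  have hsr : ∀ j, ψ (sr j) * ψ (sr j) = 1 := fun j => by rw [← map_mul, sr_mul_self, map_one]
  cases x with
  | sr j => exact hsr j
  | r i =>
    have hi : (r i : DihedralGroup n) = sr 0 * sr i := by rw [sr_mul_sr, sub_zero]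
    rw [hi, map_mul, mul_assoc, ← mul_assoc (ψ (sr i)), hψ (sr i) (sr 0), mul_assoc, hsr, mul_one,
      hsr]

/-- Two distinct solutions differ by an element of order two, and `ZMod n` has at most one of these,
namely `n / 2`. -/
theorem card_add_self_eq_le_two {n : ℕ} [NeZero n] (c : ZMod n) :
    (Finset.univ.filter fun i : ZMod n => i + i = c).card ≤ 2 := by
  by_contra! h
  obtain ⟨x, hx, y, hy, z, hz, hxy, hxz, hyz⟩ := Finset.two_lt_card.mp h
  simp only [Finset.mem_filter, Finset.mem_univ, true_and] at hx hy hz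
  have half : ∀ t, x ≠ t → t + t = c → 2 * (x - t).val = n := by
    intro t hxt ht
    refine ((ZMod.neg_eq_self_iff _).mp ?_).resolve_left (sub_ne_zero.mpr hxt)
    linear_combination ht - hx
  have h1 := half y hxy hy
  have h2 := half z hxz hz
  exact hyz (sub_right_injective (ZMod.val_injective n (by omega : (x - y).val = (x - z).val)))

/-- An involution of `D_n` that commutes with more than four elements is central. -/
theorem central_of_commute {n : ℕ} (hn : 5 ≤ n) {b : DihedralGroup n} (hb : b * b = 1)
    {f : ZMod n → DihedralGroup n} (hf : Function.Injective f)
    (hcomm : ∀ j, b * f j = f j * b) (x : DihedralGroup n) : b * x = x * b := by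
  have : NeZero n := ⟨by omega⟩
  cases b with
  | r i =>
    rw [r_mul_r, one_def, r.injEq] at hb
    cases x with
    | r j => rw [r_mul_r, r_mul_r, add_comm]
    | sr j =>
      rw [r_mul_sr, sr_mul_r, sr.injEq]
      linear_combination -hb
  | sr y =>
    exfalso
    -- A reflection `sr y` commutes only with the `r i` with `2i = 0` and the `sr i` with `2i = 2y`:
    -- at most two of each, fewer than `n`.
    have hsub : Finset.univ.image f ⊆
        (Finset.univ.filter fun i : ZMod n => i + i = 0).image r ∪
          (Finset.univ.filter fun i : ZMod n => i + i = y + y).image sr := by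
      intro g hg
      obtain ⟨j, -, rfl⟩ := Finset.mem_image.mp hg
      have hj := hcomm j
      cases hfj : f j with
      | r i =>
        rw [hfj, sr_mul_r, r_mul_sr, sr.injEq] at hj
        refine Finset.mem_union_left _ (Finset.mem_image.mpr ⟨i, ?_, rfl⟩)
        simp only [Finset.mem_filter, Finset.mem_univ, true_and]
        linear_combination hj
      | sr i =>
        rw [hfj, sr_mul_sr, sr_mul_sr, r.injEq] at hj
        refine Finset.mem_union_right _ (Finset.mem_image.mpr ⟨i, ?_, rfl⟩)
        simp only [Finset.mem_filter, Finset.mem_univ, true_and]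
        linear_combination hj
    have hcard := (Finset.card_le_card hsub).trans ((Finset.card_union_le _ _).trans
      (add_le_add (Finset.card_image_le.trans (card_add_self_eq_le_two 0))
        (Finset.card_image_le.trans (card_add_self_eq_le_two (y + y)))))
    rw [Finset.card_image_of_injective _ hf, Finset.card_univ, ZMod.card] at hcard
    omega

/-- The involution of the set `D_n` that fixes the rotations and multiplies the index of each
reflection by a square root `w` of `1`. -/
def twist {n : ℕ} (w : ZMod n) (hw : w * w = 1) : DihedralGroup n ≃ DihedralGroup n :=
  Function.Involutive.toPerm
    (fun g => match g with
      | r i => r i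
      | sr i => sr (w * i))
    (fun g => match g with
      | r i => rfl
      | sr i => by simp only [← mul_assoc, hw, one_mul])

theorem twist_r {n : ℕ} (w : ZMod n) (hw : w * w = 1) (i : ZMod n) : twist w hw (r i) = r i := rfl

theorem twist_sr {n : ℕ} (w : ZMod n) (hw : w * w = 1) (i : ZMod n) :
    twist w hw (sr i) = sr (w * i) := rfl

theorem twist_symm_r {n : ℕ} (w : ZMod n) (hw : w * w = 1) (i : ZMod n) :
    (twist w hw).symm (r i) = r i := rfl

theorem twist_symm_sr {n : ℕ} (w : ZMod n) (hw : w * w = 1) (i : ZMod n) :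
    (twist w hw).symm (sr i) = sr (w * i) := rfl

/-- The relation says that `b ↦ a⁻¹ (a ∘ b)` is multiplicative. For `a = r i` this map fixes
rotations and shifts reflections by `(1 - w) * i`; for a reflection it scales indices by `w`, up to
a shift on reflections. -/
theorem twist_brace_rel {n : ℕ} (w : ZMod n) (hw : w * w = 1) (a b c : DihedralGroup n) :
    (twist w hw).symm (twist w hw a * twist w hw (b * c)) =
      (twist w hw).symm (twist w hw a * twist w hw b) * a⁻¹ *
        (twist w hw).symm (twist w hw a * twist w hw c) := by
  cases a <;> cases b <;> cases c <;>
    simp only [twist_r, twist_sr, twist_symm_r, twist_symm_sr, r_mul_r, r_mul_sr, sr_mul_r,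
      sr_mul_sr, inv_r, inv_sr, r.injEq, sr.injEq] <;> ring_nf <;>
    simp only [sq, hw] <;> ring

/-- A brace of type `D_n` on a set in bijection with `D_n`, whose operation `∘` is transported along
a twist. -/
def twistedBrace {n : ℕ} {B : Type u} (e : B ≃ DihedralGroup n) (w : ZMod n) (hw : w * w = 1) :
    SkewBrace B where
  dot := e.group
  circ := (e.trans (twist w hw)).group
  brace_rel := fun a b c => by
    refine e.injective ?_
    have := twist_brace_rel w hw (e a) (e b) (e c)
    change e (e.symm ((twist w hw).symm (twist w hw (e a) *
      twist w hw (e (e.symm (e b * e c)))))) = e (e.symm (e (e.symm (e (e.symm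
      ((twist w hw).symm (twist w hw (e a) * twist w hw (e b)))) * e (e.symm (e a)⁻¹))) *
      e (e.symm ((twist w hw).symm (twist w hw (e a) * twist w hw (e c))))))
    simpa only [Equiv.apply_symm_apply] using this

theorem twistedBrace_isOfType {n : ℕ} {B : Type u} (e : B ≃ DihedralGroup n) (w : ZMod n)
    (hw : w * w = 1) :
    (twistedBrace e w hw).IsOfType (DihedralGroup n) (DihedralGroup n) :=
  ⟨⟨{ e with map_mul' := fun _ _ => e.apply_symm_apply _ }⟩,
    ⟨{ e.trans (twist w hw) with
      map_mul' := fun _ _ => (e.trans (twist w hw)).apply_symm_apply _ }⟩⟩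

theorem twistedBrace_solution {n : ℕ} {B : Type u} (e : B ≃ DihedralGroup n) (w : ZMod n)
    (hw : w * w = 1) (g h y z : DihedralGroup n)
    (hy : y = g⁻¹ * (twist w hw).symm (twist w hw g * twist w hw h))
    (hz : z = (twist w hw).symm ((twist w hw y)⁻¹ * twist w hw g * twist w hw h)) :
    (twistedBrace e w hw).solution (e.symm g, e.symm h) = (e.symm y, e.symm z) := by
  have h1 : ((twistedBrace e w hw).solution (e.symm g, e.symm h)).1 = e.symm y := by
    change e.symm (e (e.symm (e (e.symm g))⁻¹) * e (e.symm ((twist w hw).symm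
      (twist w hw (e (e.symm g)) * twist w hw (e (e.symm h)))))) = e.symm y
    simp only [Equiv.apply_symm_apply, hy]
  refine Prod.ext h1 ?_
  have h2 : ((twistedBrace e w hw).solution (e.symm g, e.symm h)).2 =
      (twistedBrace e w hw).circ.mul ((twistedBrace e w hw).circ.mul
        ((twistedBrace e w hw).circ.inv
          ((twistedBrace e w hw).solution (e.symm g, e.symm h)).1) (e.symm g)) (e.symm h) := rfl
  rw [h2, h1]
  change (e.trans (twist w hw)).symm ((e.trans (twist w hw)) ((e.trans (twist w hw)).symm
    ((e.trans (twist w hw)) ((e.trans (twist w hw)).symm ((e.trans (twist w hw)) (e.symm y))⁻¹) *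
      (e.trans (twist w hw)) (e.symm g))) * (e.trans (twist w hw)) (e.symm h)) = e.symm z
  rw [Equiv.apply_symm_apply, Equiv.apply_symm_apply, hz]
  simp only [Equiv.trans_apply, Equiv.symm_trans_apply, Equiv.apply_symm_apply]

theorem not_obtainsEverySolution {n : ℕ} (hn : 5 ≤ n) {w : ZMod n} (hw : w * w = 1)
    (h1 : w ≠ 1) (h2 : w ≠ -1) : ¬ObtainsEverySolution.{u, 0} (DihedralGroup n) := by
  intro h
  let e : ULift.{u} (DihedralGroup n) ≃ DihedralGroup n := Equiv.ulift
  have hr : Function.Injective fun j : ZMod n => (r j : DihedralGroup n) := fun a b hab => by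
    simpa using hab
  obtain ⟨ψ, hψ, ⟨E, hE⟩ | ⟨E, hE⟩⟩ := h _ _ ⟨_, twistedBrace_isOfType e w hw, rfl⟩
  · have key : ∀ g k : DihedralGroup n, (ψ (E (e.symm g)))⁻¹ * E (e.symm k) * ψ (E (e.symm g)) =
        E (e.symm (g⁻¹ * (twist w hw).symm (twist w hw g * twist w hw k))) := by
      intro g k
      have := congrArg Prod.fst (hE (e.symm g, e.symm k))
      rw [twistedBrace_solution e w hw g k _ _ rfl rfl] at this
      simpa only [fpfSolution, Prod.map, map_inv] using this
    -- For first argument `r 1` the first component fixes every rotation, so the conjugating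
    -- involution is central and the component must fix `sr 0` too. It sends `sr 0` to `sr (1 - w)`,
    -- forcing `w = 1`.
    have hc := central_of_commute hn (map_mul_self_of_isAbelianEnd hψ.2 (E (e.symm (r 1))))
      (f := fun j => E (e.symm (r j))) (E.injective.comp (e.symm.injective.comp hr)) (by
        intro j
        have := key (r 1) (r j)
        simp only [twist_r, twist_symm_r, r_mul_r, inv_r, neg_add_cancel_left] at this
        rw [mul_assoc, inv_mul_eq_iff_eq_mul] at this
        exact this.symm)
    have hk := key (r 1) (sr 0)
    rw [mul_assoc, inv_mul_eq_iff_eq_mul, ← hc, mul_right_inj, E.apply_eq_iff_eq,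
      e.symm.apply_eq_iff_eq] at hk
    simp only [twist_r, twist_sr, twist_symm_sr, r_mul_sr, inv_r, sr.injEq] at hk
    exact h1 (by linear_combination hk)
  · have key : ∀ g k : DihedralGroup n, ψ (E (e.symm k)) * E (e.symm g) * (ψ (E (e.symm k)))⁻¹ =
        E (e.symm ((twist w hw).symm ((twist w hw (g⁻¹ * (twist w hw).symm
          (twist w hw g * twist w hw k)))⁻¹ * twist w hw g * twist w hw k))) := by
      intro g k
      have := congrArg Prod.snd (hE (e.symm g, e.symm k))
      rw [twistedBrace_solution e w hw g k _ _ rfl rfl] at this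
      simpa only [fpfSolutionOpp, Prod.map, map_inv] using this
    -- For `R'_ψ` the second component is the conjugation. With second argument `r 1` it fixes every
    -- rotation but sends `sr 0` to `sr (w + 1)`, forcing `w = -1`.
    have hc := central_of_commute hn (map_mul_self_of_isAbelianEnd hψ.2 (E (e.symm (r 1))))
      (f := fun j => E (e.symm (r j))) (E.injective.comp (e.symm.injective.comp hr)) (by
        intro j
        have := key (r j) (r 1)
        rw [mul_inv_eq_iff_eq_mul] at this
        rw [this]
        simp only [twist_r, twist_symm_r, r_mul_r, inv_r]
        congr 4
        ring)
    have hk := key (sr 0) (r 1)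
    rw [hc, mul_inv_cancel_right, E.apply_eq_iff_eq, e.symm.apply_eq_iff_eq] at hk
    simp only [twist_r, twist_sr, twist_symm_sr, sr_mul_r, sr_mul_sr, r_mul_sr, inv_r, inv_sr,
      sr.injEq] at hk
    exact h2 (by linear_combination -hk - hw)

theorem eq_prime_pow_of_obtainsEverySolution {n : ℕ} (hn : 3 ≤ n)
    (h : ObtainsEverySolution.{u, 0} (DihedralGroup n)) :
    (∃ p k : ℕ, p.Prime ∧ Odd p ∧ 0 < k ∧ n = p ^ k) ∨
      (∃ p k : ℕ, p.Prime ∧ Odd p ∧ 0 < k ∧ n = 2 * p ^ k) ∨ n = 4 := by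
  by_contra hcon
  obtain ⟨w, hw, h1, h2⟩ := ZMod.exists_sq_eq_one hn hcon
  have h3 : n ≠ 3 := by
    rintro rfl
    exact hcon (Or.inl ⟨3, 1, by norm_num, by decide, one_pos, rfl⟩)
  have h4 : n ≠ 4 := fun h4 => hcon (Or.inr (Or.inr h4))
  exact not_obtainsEverySolution (by omega) hw h1 h2 h

end DihedralGroup

/-! ### Classification of the braces when `1` has only the square roots `±1`. -/

namespace DihedralGroup

variable {n : ℕ}

theorem one_ne_neg_one (hn : 3 ≤ n) : (1 : ZMod n) ≠ -1 :=
  have : Fact (2 < n) := ⟨hn⟩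
  ZMod.neg_one_ne_one.symm

theorem r_two_ne_one (hn : 3 ≤ n) : (r 2 : DihedralGroup n) ≠ 1 := by
  intro h
  rw [one_def, r.injEq] at h
  exact one_ne_neg_one hn (by linear_combination h)

theorem exists_natCast_eq (hn : 3 ≤ n) (i : ZMod n) : ∃ k : ℕ, (k : ZMod n) = i :=
  have : NeZero n := ⟨by omega⟩
  ⟨i.val, ZMod.natCast_zmod_val i⟩

/-- An injective endomorphism of `D_n` acts by an affine map on the indices of the reflections. -/
theorem exists_affine_of_injective (hn : 3 ≤ n) (f : DihedralGroup n →* DihedralGroup n)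
    (hf : Function.Injective f) :
    ∃ u c : ZMod n, (∀ i, f (r i) = r (u * i)) ∧ ∀ j, f (sr j) = sr (c + u * j) := by
  obtain ⟨u, hu⟩ : ∃ u, f (r 1) = r u := by
    cases h : f (r 1) with
    | r u => exact ⟨u, rfl⟩
    | sr u =>
      have := orderOf_injective f hf (r 1)
      rw [h, orderOf_sr, orderOf_r_one] at this
      omega
  have hr : ∀ i, f (r i) = r (u * i) := by
    intro i
    obtain ⟨k, rfl⟩ := exists_natCast_eq hn i
    rw [← r_one_pow, map_pow, hu, r_pow]
  obtain ⟨c, hc⟩ : ∃ c, f (sr 0) = sr c := by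
    cases h : f (sr 0) with
    | sr c => exact ⟨c, rfl⟩
    | r c =>
      exfalso
      -- If `sr 0` went to a rotation, it would commute with `r 1` by injectivity.
      have : f (sr 0 * r 1) = f (r 1 * sr 0) := by
        rw [map_mul, map_mul, h, hu, r_mul_r, r_mul_r, add_comm]
      have := hf this
      rw [sr_mul_r, r_mul_sr, sr.injEq, zero_add, zero_sub] at this
      exact one_ne_neg_one hn this
  refine ⟨u, c, hr, fun j => ?_⟩
  rw [← zero_add j, ← sr_mul_r, map_mul, hc, hr, sr_mul_r, zero_add]

/-- A brace `(D_n, ·, ∘)` with `(D_n, ∘) ≅ D_n`, given by the maps `lam g : h ↦ g⁻¹ (g ∘ h)` and the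
isomorphism `iso` from `(D_n, ∘)` to `D_n`, in the coordinates
`lam g (r i) = r (lin g * i)`, `lam g (sr j) = sr (off g + lin g * j)`. -/
structure BraceData (n : ℕ) where
  lam : DihedralGroup n → DihedralGroup n →* DihedralGroup n
  iso : DihedralGroup n ≃ DihedralGroup n
  iso_circ : ∀ g h, iso (g * lam g h) = iso g * iso h
  lin : DihedralGroup n → ZMod n
  off : DihedralGroup n → ZMod n
  lam_r : ∀ g i, lam g (r i) = r (lin g * i)
  lam_sr : ∀ g j, lam g (sr j) = sr (off g + lin g * j)

theorem exists_braceData (hn : 3 ≤ n) (L : DihedralGroup n → DihedralGroup n →* DihedralGroup n)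
    (φ : DihedralGroup n ≃ DihedralGroup n) (h : ∀ g k, φ (g * L g k) = φ g * φ k) :
    ∃ X : BraceData n, X.lam = L ∧ X.iso = φ := by
  have hinj : ∀ g, Function.Injective (L g) := by
    intro g a b hab
    have := h g a
    rw [hab, h, mul_right_inj, φ.apply_eq_iff_eq] at this
    exact this.symm
  choose u c hr hsr using fun g => exists_affine_of_injective hn (L g) (hinj g)
  exact ⟨⟨L, φ, h, u, c, hr, hsr⟩, rfl, rfl⟩

namespace BraceData

variable (X : BraceData n)

/-- Associativity of `∘`, tested through `iso`: `lam` is an action of `(D_n, ∘)`. -/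
theorem lam_circ (g h x : DihedralGroup n) : X.lam (g * X.lam g h) x = X.lam g (X.lam h x) := by
  have h1 : X.iso (g * X.lam g h * X.lam (g * X.lam g h) x) =
      X.iso (g * X.lam g (h * X.lam h x)) := by
    rw [X.iso_circ, X.iso_circ, X.iso_circ, X.iso_circ, mul_assoc]
  rw [X.iso.apply_eq_iff_eq, map_mul, ← mul_assoc, mul_right_inj] at h1
  exact h1

theorem lin_circ (g h : DihedralGroup n) : X.lin (g * X.lam g h) = X.lin g * X.lin h := by
  have := X.lam_circ g h (r 1)
  simpa only [X.lam_r, mul_one, r.injEq] using this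

theorem off_circ (g h : DihedralGroup n) :
    X.off (g * X.lam g h) = X.off g + X.lin g * X.off h := by
  have := X.lam_circ g h (sr 0)
  simpa only [X.lam_sr, mul_zero, add_zero, sr.injEq] using this

theorem iso_one : X.iso 1 = 1 := by
  have := X.iso_circ 1 1
  rw [map_one, mul_one] at this
  exact left_eq_mul.mp this

theorem iso_r_zero : X.iso (r 0) = 1 := by rw [r_zero, X.iso_one]

theorem lam_one (h : DihedralGroup n) : X.lam 1 h = h := by
  have := X.iso_circ 1 h
  rwa [one_mul, X.iso_one, one_mul, X.iso.apply_eq_iff_eq] at this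

theorem lin_one : X.lin 1 = 1 := by
  have := X.lam_one (r 1)
  simpa only [X.lam_r, mul_one, r.injEq] using this

theorem off_one : X.off 1 = 0 := by
  have := X.lam_one (sr 0)
  simpa only [X.lam_sr, mul_zero, add_zero, sr.injEq] using this

theorem symm_mul (x y : DihedralGroup n) :
    X.iso.symm (x * y) = X.iso.symm x * X.lam (X.iso.symm x) (X.iso.symm y) := by
  rw [Equiv.symm_apply_eq, X.iso_circ, Equiv.apply_symm_apply, Equiv.apply_symm_apply]

theorem lin_symm_mul (x y : DihedralGroup n) :
    X.lin (X.iso.symm (x * y)) = X.lin (X.iso.symm x) * X.lin (X.iso.symm y) := by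
  rw [symm_mul, lin_circ]

theorem symm_one : X.iso.symm 1 = 1 := by
  rw [Equiv.symm_apply_eq, X.iso_one]

/-- `lin` is a homomorphism from `(D_n, ∘) ≅ D_n` to a commutative monoid, and `D_n` is generated by
involutions. -/
theorem lin_mul_self (g : DihedralGroup n) : X.lin g * X.lin g = 1 := by
  have hsr : ∀ j, X.lin (X.iso.symm (sr j)) * X.lin (X.iso.symm (sr j)) = 1 := fun j => by
    rw [← lin_symm_mul, sr_mul_self, symm_one, lin_one]
  obtain ⟨x, rfl⟩ := X.iso.symm.surjective g
  cases x with
  | sr j => exact hsr j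
  | r i =>
    have hi : (r i : DihedralGroup n) = sr 0 * sr i := by rw [sr_mul_sr, sub_zero]
    rw [hi, lin_symm_mul]
    linear_combination (X.lin (X.iso.symm (sr i)) * X.lin (X.iso.symm (sr i))) * hsr 0 + hsr i

theorem lin_symm_r (k : ℕ) : X.lin (X.iso.symm (r k)) = X.lin (X.iso.symm (r 1)) ^ k := by
  induction k with
  | zero => rw [Nat.cast_zero, r_zero, symm_one, lin_one, pow_zero]
  | succ k ih => rw [Nat.cast_succ, ← r_mul_r, lin_symm_mul, ih, pow_succ]

theorem iso_r_mul {i : ZMod n} (hi : X.lin (r i) = 1) (k : ℕ) :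
    X.iso (r (i * k)) = X.iso (r i) ^ k := by
  induction k with
  | zero => rw [Nat.cast_zero, mul_zero, X.iso_r_zero, pow_zero]
  | succ k ih =>
    have := X.iso_circ (r i) (r (i * k))
    rw [X.lam_r, hi, one_mul, r_mul_r] at this
    rw [pow_succ', ← ih, ← this]
    congr 2
    push_cast
    ring

/-- If the maps `lam g` fix the rotations whenever `g` is a rotation, then the brace is trivial or
almost trivial. -/
theorem lam_of_lin_r_eq_one (hn : 3 ≤ n) (hP : ∀ w : ZMod n, w * w = 1 → w = 1 ∨ w = -1)
    (h : ∀ i, X.lin (r i) = 1) :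
    (∀ g k, X.lam g k = k) ∨ ∀ g k, X.lam g k = g⁻¹ * k * g := by
  have : NeZero n := ⟨by omega⟩
  have hmul := X.iso_r_mul (h 1)
  simp only [one_mul] at hmul
  obtain ⟨a, ha⟩ : ∃ a, X.iso (r 1) = r a := by
    cases ha : X.iso (r 1) with
    | r a => exact ⟨a, rfl⟩
    | sr a =>
      exfalso
      have h2 := hmul 2
      rw [ha, sq, sr_mul_self, ← X.iso_one, X.iso.apply_eq_iff_eq] at h2
      exact r_two_ne_one hn (by simpa using h2)
  have har : ∀ i, X.iso (r i) = r (a * i) := by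
    intro i
    obtain ⟨k, rfl⟩ := exists_natCast_eq hn i
    rw [hmul, ha, r_pow]
  have hsurj : Function.Surjective fun i : ZMod n => a * i := by
    refine Finite.injective_iff_surjective.mp fun i j hij => ?_
    have hij' : X.iso (r i) = X.iso (r j) := by
      rw [har, har]
      exact congrArg r hij
    simpa using hij'
  have hsr : ∀ j, ∃ y, X.iso (sr j) = sr y := by
    intro j
    cases hj : X.iso (sr j) with
    | sr y => exact ⟨y, rfl⟩
    | r x =>
      exfalso
      obtain ⟨i, rfl⟩ := hsurj x
      have hj' : X.iso (sr j) = X.iso (r i) := by rw [hj, har]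
      simp at hj'
  -- The dihedral relation `sr y * r x = r (-x) * sr y`, pulled back through `iso`. With the
  -- involution relation below it expresses all of `lam` by the single root `lin (sr 0)`.
  have hlin : ∀ j i, X.lin (sr j) * i = X.off (r (-i)) + i := by
    intro j i
    obtain ⟨y, hy⟩ := hsr j
    have h1 : X.iso (sr j * X.lam (sr j) (r i)) = X.iso (r (-i) * X.lam (r (-i)) (sr j)) := by
      rw [X.iso_circ, X.iso_circ, hy, har, har, sr_mul_r, r_mul_sr]
      congr 1
      ring
    rw [X.iso.apply_eq_iff_eq, X.lam_r, X.lam_sr, h, sr_mul_r, r_mul_sr, sr.injEq] at h1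
    linear_combination h1
  have hw : ∀ j, X.lin (sr j) = X.lin (sr 0) := fun j => by
    linear_combination hlin j 1 - hlin 0 1
  have hoffr : ∀ i, X.off (r i) = i - X.lin (sr 0) * i := by
    intro i
    have := hlin 0 (-i)
    rw [neg_neg] at this
    linear_combination -this
  have hoffsr : ∀ j, X.off (sr j) = j - X.lin (sr 0) * j := by
    intro j
    obtain ⟨y, hy⟩ := hsr j
    have h1 := X.iso_circ (sr j) (sr j)
    rw [hy, sr_mul_self, ← X.iso_one, X.iso.apply_eq_iff_eq, X.lam_sr, hw, sr_mul_sr, one_def,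
      r.injEq] at h1
    linear_combination h1
  rcases hP _ (X.lin_mul_self (sr 0)) with hone | hone
  · left
    intro g k
    cases g <;> cases k <;> simp [X.lam_r, X.lam_sr, h, hw, hoffr, hoffsr, hone]
  · right
    intro g k
    cases g <;> cases k <;> simp [X.lam_r, X.lam_sr, h, hw, hoffr, hoffsr, hone] <;> ring

/-- If some `lam (r i)` inverts the rotations, the element corresponding to the generating rotation
of `(D_n, ∘)` is a reflection. -/
theorem exists_symm_r_one_eq_sr (hn : 3 ≤ n) (hP : ∀ w : ZMod n, w * w = 1 → w = 1 ∨ w = -1)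
    {i₀ : ZMod n} (h : X.lin (r i₀) = -1) : ∃ j, X.iso.symm (r 1) = sr j := by
  have : NeZero n := ⟨by omega⟩
  cases ht : X.iso.symm (r 1) with
  | sr j => exact ⟨j, rfl⟩
  | r i =>
    exfalso
    have ht' : X.iso (r i) = r 1 := by rw [← ht, X.iso.apply_symm_apply]
    -- With linear part `1`, the `∘`-powers of `r i` exhaust the rotations, so all would have linear
    -- part `1`, against `i₀`. With linear part `-1`, `r i ∘ r i = 1`, although `r 1` does not
    -- square to `1`.
    rcases hP _ (X.lin_mul_self (r i)) with hu | hu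
    · have hmul : ∀ k, X.iso (r (i * k)) = r k := by
        intro k
        obtain ⟨k, rfl⟩ := exists_natCast_eq hn k
        rw [X.iso_r_mul hu, ht', r_one_pow]
      have hsurj : Function.Surjective fun k : ZMod n => i * k := by
        refine Finite.injective_iff_surjective.mp fun k l hkl => ?_
        have hkl' : i * k = i * l := hkl
        have h1 := hmul k
        rw [hkl', hmul, r.injEq] at h1
        exact h1.symm
      obtain ⟨k, hk⟩ := hsurj i₀
      have hk' : i * k = i₀ := hk
      obtain ⟨k, rfl⟩ := exists_natCast_eq hn k
      have h1 := X.lin_symm_r k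
      rw [ht, hu, one_pow, ← hmul, Equiv.symm_apply_apply, hk', h] at h1
      exact one_ne_neg_one hn h1.symm
    · have h2 := X.iso_circ (r i) (r i)
      rw [X.lam_r, hu, r_mul_r, ht', r_mul_r, neg_one_mul, add_neg_cancel, X.iso_r_zero,
        one_add_one_eq_two] at h2
      exact r_two_ne_one hn h2.symm

/-- The main case of the classification: `lam` takes exactly two values, the identity and the
conjugation by a reflection. -/
theorem exists_fpf_of_lin_eq_neg_one (hn : 3 ≤ n)
    (hP : ∀ w : ZMod n, w * w = 1 → w = 1 ∨ w = -1) {i₀ j₀ : ZMod n} (hi₀ : X.lin (r i₀) = -1)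
    (ht : X.iso (sr j₀) = r 1) (hj₀ : X.lin (sr j₀) = -1) :
    ∃ ψ ∈ FPF (DihedralGroup n), ∀ g k, X.lam g k = (ψ g)⁻¹ * k * ψ g := by
  have hne := one_ne_neg_one hn
  set c := X.off (sr j₀) with hc
  -- Chosen so that `sr j₀ ∘ sr j₀ = r q`; its `∘`-powers correspond to the even powers of the
  -- generating rotation.
  set q := c - j₀ - j₀ with hq
  have htt : sr j₀ * X.lam (sr j₀) (sr j₀) = r q := by
    rw [X.lam_sr, hj₀, sr_mul_sr, r.injEq]
    ring
  have hφq : X.iso (r q) = r 2 := by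
    rw [← htt, X.iso_circ, ht, r_mul_r, one_add_one_eq_two]
  have hlinq : X.lin (r q) = 1 := by
    rw [← htt, X.lin_circ, hj₀, neg_one_mul, neg_neg]
  have hpow : ∀ k : ℕ, X.iso (r (q * k)) = r (2 * (k : ZMod n)) := fun k => by
    rw [X.iso_r_mul hlinq, hφq, r_pow]
  have hsymm2 : ∀ k : ℕ, X.iso.symm (r (2 * (k : ZMod n))) = r (q * (k : ZMod n)) := fun k => by
    rw [← hpow, Equiv.symm_apply_apply]
  have hsymm1 : X.iso.symm (r 1) = sr j₀ := by rw [← ht, Equiv.symm_apply_apply]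
  obtain ⟨k₀, hk₀⟩ : ∃ k, X.iso (r i₀) = sr k := by
    cases hk : X.iso (r i₀) with
    | sr k => exact ⟨k, rfl⟩
    | r k =>
      exfalso
      obtain ⟨k, rfl⟩ := exists_natCast_eq hn k
      rw [← Equiv.eq_symm_apply] at hk
      -- Even `∘`-powers of `sr j₀` have linear part `1`, and odd ones are reflections; `r i₀` is
      -- neither.
      rcases Nat.even_or_odd' k with ⟨m, rfl | rfl⟩
      · have h1 := X.lin_symm_r (2 * m)
        rw [← hk, hi₀, hsymm1, hj₀, pow_mul, neg_one_sq, one_pow] at h1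
        exact hne h1.symm
      · rw [Nat.cast_succ, add_comm, ← r_mul_r, symm_mul, hsymm1, Nat.cast_mul, Nat.cast_ofNat,
          hsymm2, X.lam_r, sr_mul_r] at hk
        cases hk
  -- `r i₀ ∘ sr j₀` corresponds to a reflection, hence is a `∘`-involution. It is itself a
  -- reflection with linear part `1`, so its offset `off (r i₀) - c` vanishes.
  have hoff₀ : X.off (r i₀) = c := by
    have h1 : X.iso (r i₀ * X.lam (r i₀) (sr j₀)) = sr (k₀ + 1) := by
      rw [X.iso_circ, hk₀, ht, sr_mul_r]
    have hl := X.lin_circ (r i₀) (sr j₀)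
    have ho := X.off_circ (r i₀) (sr j₀)
    rw [X.lam_sr, r_mul_sr] at h1 hl ho
    generalize X.off (r i₀) + X.lin (r i₀) * j₀ - i₀ = y at h1 hl ho
    have h2 := X.iso_circ (sr y) (sr y)
    rw [h1, sr_mul_self, ← X.iso_one, X.iso.apply_eq_iff_eq, X.lam_sr, sr_mul_sr, one_def,
      r.injEq, hl, ho, hi₀, hj₀, ← hc] at h2
    linear_combination h2
  -- The `∘`-generators `sr j₀` and `r i₀` act by the same involution `r i ↦ r (-i)`, `sr j ↦ sr (c
  -- - j)`, so `lam` has only two possible values.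
  have hval : ∀ g, (X.lin g = 1 ∧ X.off g = 0) ∨ (X.lin g = -1 ∧ X.off g = c) := by
    have hmul : ∀ g k, ((X.lin g = 1 ∧ X.off g = 0) ∨ (X.lin g = -1 ∧ X.off g = c)) →
        ((X.lin k = 1 ∧ X.off k = 0) ∨ (X.lin k = -1 ∧ X.off k = c)) →
        ((X.lin (g * X.lam g k) = 1 ∧ X.off (g * X.lam g k) = 0) ∨
          (X.lin (g * X.lam g k) = -1 ∧ X.off (g * X.lam g k) = c)) := by
      intro g k hg hk
      rw [X.lin_circ, X.off_circ]
      rcases hg with ⟨h1, h2⟩ | ⟨h1, h2⟩ <;> rcases hk with ⟨h3, h4⟩ | ⟨h3, h4⟩ <;>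
        simp [h1, h2, h3, h4]
    have hrot : ∀ k : ℕ, (X.lin (X.iso.symm (r k)) = 1 ∧ X.off (X.iso.symm (r k)) = 0) ∨
        (X.lin (X.iso.symm (r k)) = -1 ∧ X.off (X.iso.symm (r k)) = c) := by
      intro k
      induction k with
      | zero =>
        left
        rw [Nat.cast_zero, r_zero, X.symm_one]
        exact ⟨X.lin_one, X.off_one⟩
      | succ k ih =>
        rw [Nat.cast_succ, ← r_mul_r, symm_mul]
        exact hmul _ _ ih (Or.inr (by rw [hsymm1]; exact ⟨hj₀, hc.symm⟩))
    intro g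
    obtain ⟨x, rfl⟩ := X.iso.symm.surjective g
    cases x with
    | r i =>
      obtain ⟨k, rfl⟩ := exists_natCast_eq hn i
      exact hrot k
    | sr i =>
      obtain ⟨k, hk⟩ := exists_natCast_eq hn (i - k₀)
      have hi : (sr i : DihedralGroup n) = sr k₀ * r k := by rw [sr_mul_r, hk]; congr 1; ring
      rw [hi, symm_mul]
      refine hmul _ _ (Or.inr ?_) (hrot k)
      rw [← hk₀, Equiv.symm_apply_apply]
      exact ⟨hi₀, hoff₀⟩
  have hlinr : ∀ i, X.lin (r (-i)) = X.lin (r i) := by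
    have h1 : ∀ i, X.lin (r i) = 1 → X.lin (r (-i)) = 1 := by
      intro i hi
      have := X.lin_circ (r i) (r (-i))
      rw [X.lam_r, hi, one_mul, one_mul, r_mul_r, add_neg_cancel, r_zero, X.lin_one] at this
      exact this.symm
    intro i
    rcases hP _ (X.lin_mul_self (r i)) with hi | hi
    · rw [hi, h1 i hi]
    · rcases hP _ (X.lin_mul_self (r (-i))) with hi' | hi'
      · have := h1 _ hi'
        rw [neg_neg] at this
        rw [hi', this]
      · rw [hi, hi']
  have hlinsr : ∀ j, X.lin (sr (c - j)) = X.lin (sr j) := by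
    intro j
    have h1 := X.lin_circ (sr j₀) (sr j)
    have h2 := X.lin_circ (sr j₀) (r (-(c - j - j₀)))
    rw [X.lam_sr, hj₀, ← hc, sr_mul_sr, show c + -1 * j - j₀ = c - j - j₀ by ring] at h1
    rw [X.lam_r, hj₀, sr_mul_r, show j₀ + -1 * -(c - j - j₀) = c - j by ring, hlinr, h1] at h2
    linear_combination h2
  have hlinlam : ∀ g k, X.lin (X.lam g k) = X.lin k := by
    intro g k
    rcases hval g with ⟨h1, h2⟩ | ⟨h1, h2⟩ <;> cases k <;>
      simp [X.lam_r, X.lam_sr, h1, h2, hlinr, ← sub_eq_add_neg, hlinsr]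
  have hlamlam : ∀ g k, X.lam g (X.lam g k) = k := by
    intro g k
    rcases hval g with ⟨h1, h2⟩ | ⟨h1, h2⟩ <;> cases k <;> simp [X.lam_r, X.lam_sr, h1, h2]
  -- Since `g * k = g ∘ lam g k` and `lin` is `lam`-invariant, `lin` is also a homomorphism for the
  -- original multiplication.
  have hlinmul : ∀ g k, X.lin (g * k) = X.lin g * X.lin k := by
    intro g k
    have := X.lin_circ g (X.lam g k)
    rwa [hlamlam, hlinlam] at this
  have hlinpow : ∀ k : ℕ, X.lin (r k) = X.lin (r 1) ^ k := by
    intro k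
    induction k with
    | zero => rw [Nat.cast_zero, r_zero, X.lin_one, pow_zero]
    | succ k ih => rw [Nat.cast_succ, ← r_mul_r, hlinmul, ih, pow_succ]
  have hlin1 : X.lin (r 1) = -1 := by
    refine (hP _ (X.lin_mul_self (r 1))).resolve_left fun h1 => hne ?_
    obtain ⟨k, rfl⟩ := exists_natCast_eq hn i₀
    rw [← hi₀, hlinpow, h1, one_pow]
  rw [hlin1] at hlinpow
  have heven : ∀ k : ℕ, X.lin (r k) = 1 → Even k := fun k hk =>
    (neg_one_pow_eq_one_iff_even hne.symm).mp ((hlinpow k).symm.trans hk)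
  obtain ⟨m, hm⟩ := heven n (by rw [ZMod.natCast_self, r_zero, X.lin_one])
  obtain ⟨q', hq'⟩ := exists_natCast_eq hn q
  obtain ⟨d, hd⟩ := heven q' (by rw [hq', hlinq])
  have hmm : (m : ZMod n) + m = 0 := by rw [← Nat.cast_add, ← hm, ZMod.natCast_self]
  have hdd : (d : ZMod n) + d = q := by rw [← Nat.cast_add, ← hd, hq']
  -- A half of `q` makes `sr (j₀ + δ)` conjugate as required; oddness gives it linear part `1`,
  -- hence `ψ b = 1` and no fixed points. The halves are `d` and `d + m` with `n = 2 * m`. Were `d`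
  -- and `m` both even, `q * (m / 2)` would vanish, so `r m` would be trivial.
  obtain ⟨δ, hδodd, hδ⟩ : ∃ δ : ℕ, Odd δ ∧ (δ : ZMod n) + δ = q := by
    rcases Nat.even_or_odd' d with ⟨d', rfl | rfl⟩
    · rcases Nat.even_or_odd' m with ⟨m', rfl | rfl⟩
      · exfalso
        have h1 := hpow m'
        have h2 : q * (m' : ZMod n) = 0 := by
          rw [← hdd]
          push_cast at hmm ⊢
          linear_combination (d' : ZMod n) * hmm
        rw [h2, X.iso_r_zero, one_def, r.injEq] at h1
        have h3 : ((2 * m' : ℕ) : ZMod n) = 0 := by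
          push_cast
          exact h1.symm
        have := Nat.le_of_dvd (by omega) ((ZMod.natCast_eq_zero_iff _ _).mp h3)
        omega
      · refine ⟨2 * d' + (2 * m' + 1), ⟨d' + m', by ring⟩, ?_⟩
        rw [Nat.cast_add]
        linear_combination hdd + hmm
    · exact ⟨_, ⟨d', rfl⟩, hdd⟩
  set b : DihedralGroup n := sr (j₀ + δ) with hb
  have hlinb : X.lin b = 1 := by
    rw [hb, ← sr_mul_r, hlinmul, hlinpow, hj₀, hδodd.neg_one_pow, neg_one_mul, neg_neg]
  have hbc : j₀ + δ + (j₀ + δ) = c := by linear_combination hδ + hq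
  have hbb : b * b = 1 := sr_mul_self _
  classical
  let ψ : DihedralGroup n →* DihedralGroup n :=
    { toFun := fun g => if X.lin g = 1 then 1 else b
      map_one' := if_pos X.lin_one
      map_mul' := fun g k => by
        rcases hP _ (X.lin_mul_self g) with hg | hg <;>
          rcases hP _ (X.lin_mul_self k) with hk | hk <;>
          simp [hlinmul, hg, hk, hne.symm, hbb] }
  have hψ1 : ∀ g, X.lin g = 1 → ψ g = 1 := fun g hg => if_pos hg
  have hψb : ∀ g, X.lin g = -1 → ψ g = b := fun g hg => if_neg (by rw [hg]; exact hne.symm)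
  refine ⟨ψ, ⟨fun g hg => ?_, fun g k => ?_⟩, fun g k => ?_⟩
  · rcases hP _ (X.lin_mul_self g) with h | h
    · rw [← hg, hψ1 g h]
    · rw [hψb g h] at hg
      rw [← hg, hlinb] at h
      exact absurd h hne
  · rcases hP _ (X.lin_mul_self g) with h | h <;> rcases hP _ (X.lin_mul_self k) with h' | h' <;>
      simp [hψ1, hψb, h, h']
  · rcases hval g with ⟨h1, h2⟩ | ⟨h1, h2⟩
    · rw [hψ1 g h1]
      cases k <;> simp [X.lam_r, X.lam_sr, h1, h2]
    · rw [hψb g h1, hb]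
      cases k with
      | r i =>
        rw [X.lam_r, h1, inv_sr, sr_mul_r, sr_mul_sr, r.injEq]
        ring
      | sr i =>
        rw [X.lam_sr, h1, h2, inv_sr, sr_mul_sr, r_mul_sr, sr.injEq]
        linear_combination -hbc

end BraceData

/-- The classification of the braces of type `D_n` when `1` has no square roots other than `±1`
modulo `n`. -/
theorem exists_fpf_of_circ (hn : 3 ≤ n) (hP : ∀ w : ZMod n, w * w = 1 → w = 1 ∨ w = -1)
    (L : DihedralGroup n → DihedralGroup n →* DihedralGroup n)
    (φ : DihedralGroup n ≃ DihedralGroup n) (h : ∀ g k, φ (g * L g k) = φ g * φ k) :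
    ∃ ψ ∈ FPF (DihedralGroup n), (∀ g k, L g k = (ψ g)⁻¹ * k * ψ g) ∨
      ∀ g k, g⁻¹ * L g⁻¹ k * g = (ψ g)⁻¹ * k * ψ g := by
  obtain ⟨X, rfl, rfl⟩ := exists_braceData hn L φ h
  by_cases hi : ∀ i, X.lin (r i) = 1
  · refine ⟨1, ⟨fun g hg => hg.symm, fun g k => rfl⟩, ?_⟩
    rcases X.lam_of_lin_r_eq_one hn hP hi with h1 | h1
    · exact Or.inl fun g k => by simp [h1]
    · exact Or.inr fun g k => by simp [h1, mul_assoc]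
  · push Not at hi
    obtain ⟨i₀, hi₀⟩ := hi
    replace hi₀ := (hP _ (X.lin_mul_self _)).resolve_left hi₀
    obtain ⟨j₀, hj₀⟩ := X.exists_symm_r_one_eq_sr hn hP hi₀
    rw [Equiv.symm_apply_eq, eq_comm] at hj₀
    rcases hP _ (X.lin_mul_self (sr j₀)) with hj | hj
    -- The opposite brace, carried back to the original multiplication by inversion. The extra
    -- conjugation changes the sign of the linear part at reflections and not at rotations, giving
    -- the main case.
    · obtain ⟨Y, hYL, hYφ⟩ := exists_braceData hn
        (fun a => (MulAut.conj a⁻¹).toMonoidHom.comp (X.lam a⁻¹))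
        ((Equiv.inv (DihedralGroup n)).trans X.iso) (fun a b => by
          change X.iso (a * (a⁻¹ * X.lam a⁻¹ b * a⁻¹⁻¹))⁻¹ = X.iso a⁻¹ * X.iso b⁻¹
          rw [← X.iso_circ, map_inv (X.lam a⁻¹)]
          congr 1
          group)
      have hY : ∀ a b, Y.lam a b = a⁻¹ * X.lam a⁻¹ b * a := fun a b => by
        rw [hYL]
        simp
      have hYlin : ∀ g x, Y.lam g (r 1) = r x → Y.lin g = x := fun g x hx => by
        simpa [Y.lam_r] using hx
      obtain ⟨ψ, hψ, hψ'⟩ := Y.exists_fpf_of_lin_eq_neg_one hn hP (i₀ := -i₀) (j₀ := j₀)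
        (hYlin _ _ (by simp [hY, X.lam_r, hi₀])) (by rw [hYφ]; simpa using hj₀)
        (hYlin _ _ (by simp [hY, X.lam_r, hj]))
      exact ⟨ψ, hψ, Or.inr fun g k => by rw [← hY, hψ']⟩
    · obtain ⟨ψ, hψ, hψ'⟩ := X.exists_fpf_of_lin_eq_neg_one hn hP hi₀ hj₀ hj
      exact ⟨ψ, hψ, Or.inl hψ'⟩

theorem obtainsEveryBrace (hn : 3 ≤ n) (hP : ∀ w : ZMod n, w * w = 1 → w = 1 ∨ w = -1) :
    ObtainsEveryBrace.{u, 0} (DihedralGroup n) := by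
  rintro B A ⟨⟨e'⟩, ⟨c'⟩⟩
  let e : B ≃ DihedralGroup n := e'.toEquiv
  let c : B ≃ DihedralGroup n := c'.toEquiv
  have he : ∀ a b : B, e (A.dot.mul a b) = e a * e b := e'.map_mul
  have hei : ∀ a : B, e (A.dot.inv a) = (e a)⁻¹ := e'.toMonoidHom.map_inv
  have hc : ∀ a b : B, c (A.circ.mul a b) = c a * c b := c'.map_mul
  have hes : ∀ g k, e.symm (g * k) = A.dot.mul (e.symm g) (e.symm k) := e'.symm.map_mul
  let L : DihedralGroup n → DihedralGroup n →* DihedralGroup n := fun g =>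
    MonoidHom.mk' (fun k => g⁻¹ * e (A.circ.mul (e.symm g) (e.symm k))) (fun k l => by
      rw [hes, A.brace_rel, he, he, hei, e.apply_symm_apply]
      group)
  have hL : ∀ a b : B, e (A.circ.mul a b) = e a * L (e a) (e b) := fun a b => by
    change _ = e a * ((e a)⁻¹ * e (A.circ.mul (e.symm (e a)) (e.symm (e b))))
    rw [mul_inv_cancel_left, e.symm_apply_apply, e.symm_apply_apply]
  obtain ⟨ψ, hψ, h | h⟩ := exists_fpf_of_circ hn hP L (e.symm.trans c) (fun g k => by
    obtain ⟨a, rfl⟩ := e.surjective g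
    obtain ⟨b, rfl⟩ := e.surjective k
    rw [← hL]
    simp [hc])
  · refine ⟨ψ, hψ, Or.inl ⟨e, he, fun a b => ?_⟩⟩
    change _ = e a * ψ (e a)⁻¹ * e b * ψ (e a)
    rw [hL, h, map_inv]
    group
  · refine ⟨ψ, hψ, Or.inr ⟨e.trans (Equiv.inv _), fun a b => ?_, fun a b => ?_⟩⟩
    · change (e (A.dot.mul a b))⁻¹ = (e b)⁻¹ * (e a)⁻¹
      rw [he, mul_inv_rev]
    · change (e (A.circ.mul a b))⁻¹ = (e a)⁻¹ * ψ ((e a)⁻¹)⁻¹ * (e b)⁻¹ * ψ (e a)⁻¹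
      have := h (e a)⁻¹ (e b)
      rw [inv_inv, mul_inv_eq_iff_eq_mul] at this
      rw [hL, this]
      simp only [map_inv]
      group

end DihedralGroup

theorem mainTheorem4 (n : ℕ) (hn : 3 ≤ n) :
    List.TFAE
      [ObtainsEverySolution.{u, 0} (DihedralGroup n),
       ObtainsEveryBrace.{u, 0} (DihedralGroup n),
       ObtainsEverySubgroup (DihedralGroup n),
       (∃ p k : ℕ, p.Prime ∧ Odd p ∧ 0 < k ∧ n = p ^ k) ∨
         (∃ p k : ℕ, p.Prime ∧ Odd p ∧ 0 < k ∧ n = 2 * p ^ k) ∨ n = 4] := by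
  have : NeZero n := ⟨by omega⟩
  tfae_have 1 → 4 := DihedralGroup.eq_prime_pow_of_obtainsEverySolution hn
  tfae_have 4 → 3 := by
    intro h
    have hcyc : IsCyclic (ZMod n)ˣ := by
      rw [ZMod.isCyclic_units_iff]
      rcases h with ⟨p, k, hp, ho, hk, h⟩ | ⟨p, k, hp, ho, hk, h⟩ | h
      · exact Or.inr (Or.inr (Or.inr (Or.inr ⟨p, k, hp, ho, hk, Or.inl h⟩)))
      · exact Or.inr (Or.inr (Or.inr (Or.inr ⟨p, k, hp, ho, hk, Or.inr h⟩)))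
      · exact Or.inr (Or.inr (Or.inr (Or.inl h)))
    exact (DihedralGroup.obtainsEveryBrace hn fun _ hw =>
      ZMod.eq_one_or_eq_neg_one_of_isCyclic_units hn hcyc hw).obtainsEverySubgroup
  tfae_have 3 → 2 := ObtainsEverySubgroup.obtainsEveryBrace
  tfae_have 2 → 1 := ObtainsEveryBrace.obtainsEverySolution
  tfae_finish
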